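/- Setting. Let $\mathscr A$ be a finite-dimensional (unital) $C^\star$-algebra with space of states $\mathscr S$, and let its invertible elements $\mathrm g$ act on $\mathscr S$ by $\rho\mapsto \rho(\mathrm g^\dagger\,\cdot\,\mathrm g)/\rho(\mathrm g^\dagger \mathrm g)$. Write $\{a,b\}=\tfrac12(ab+ba)$. The tangent space at $\rho$ of the orbit $\mathcal O$ of $\rho$ consists of the functionals $\mathbb Y_a(\rho)=\rho(\{a,\cdot\})-\rho(a)\rho(\cdot)$ with $a$ self-adjoint, and $\mathcal O$ carries the Riemannian metric $\mathrm G_\rho(\mathbb Y_a(\rho),\mathbb Y_b(\rho))=\rho(\{a,b\})-\rho(a)\rho(b)$. A parametric model of states $(M,j,\mathcal O)$ consists of a smooth manifold $M$, an orbit $\mathcal O\subset\mathscr S$ and a smooth map $j\colon M\to\mathcal O$; put $\rho_m=j(m)$ and $\mathrm G^M=j^*\mathrm G$. Let $\mathcal X_n=\{\mathbf x_1,\dots,\mathbf x_n\}$ be a finite nonempty set, let $\mathscr C_n$ be the $C^\star$-algebra of complex functions on it, and let $\mathfrak m\colon\mathscr C_n\to\mathscr A$ be a positive unital linear map (a measurement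 procedure) that is regular, i.e. $j^c(m):=\rho_m\circ\mathfrak m$ lies, for every $m\in M$, in the set $\Delta_n^+$ of faithful states of $\mathscr C_n$ (the open probability simplex). Then $(M,j^c,\Delta_n^+)$ is the statistical model obtained from $(M,j,\mathcal O)$ by $\mathfrak m$. Put $\mathrm G^{Mc}=(j^c)^*\mathrm G_{FR}$, where the Fisher–Rao metric $\mathrm G_{FR}$ is the above metric of the orbit $\Delta_n^+$ for the algebra $\mathscr C_n$, and write $p^k(m)$ for the probability of $\mathbf x_k$ under $j^c(m)$. A cost function is a smooth function $C\colon M\times M\to[0,\infty)$ that vanishes exactly on the diagonal; an estimator is a map $\mathcal E\colon\mathcal X_n\to M$, with $\mathcal E_k=\mathcal E(\mathbf x_k)$. Put $L_{m_2}(m_1)=\sum_k C(m_1,\mathcal E_k)\,p^k(m_2)$. The estimator is stationary for $C$ at $m$ if the differential of $L_m$ vanishes at $m$. At such a point let $\mathrm H_m$ be the Hessian form of $L_m$ at $m$, also regarded as a map $T_mM\to T^\star_mM$; if it is invertible, put, for $\xi,\eta\in T^\star_mM$, $$\mathrm{Cov}(\xi,\eta)=\mathcal C\big(\mathrm H_m^{-1}\xi,\mathrm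 H_m^{-1}\eta\big),\qquad \mathcal C(v,w)=\sum_k v\big(C(\cdot,\mathcal E_k)\big)\,w\big(C(\cdot,\mathcal E_k)\big)\,p^k(m).$$ Proposition (generalized Helstrom bound). Assume that $\mathrm G^M$ and $\mathrm G^{Mc}$ are invertible at every point of $M$. Let $C$ be a cost function and $m_\star\in M$, let $\mathcal E$ be an estimator that is stationary for $C$ at every point of a neighbourhood of $m_\star$ (in particular, it may be stationary at every point of $M$), and let the Hessian form of $L_{m_\star}$ at $m_\star$ be invertible. Then for every $\xi\in T^\star_{m_\star}M$ $$\mathrm{Cov}(\xi,\xi)\ \ge\ (\mathrm G^{Mc}_{m_\star})^{-1}(\xi,\xi)\ \ge\ (\mathrm G^{M}_{m_\star})^{-1}(\xi,\xi).$$ The second inequality, i.e. that the noncommutative pullback metric bounds the classical Cramér–Rao bound from below, holds at every point of $M$ and for every regular measurement procedure with $\mathrm G^{Mc}$ invertible, whether or not such an estimator exists. -/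

import Mathlib

open scoped Manifold ContDiff ComplexOrder Topology

noncomputable section

namespace CStarEstimation

/-! ### States, the action of the invertible elements, gradient vectors -/

section States

variable {A : Type*} [CStarAlgebra A]

/-- A state: a positive linear functional with value `1` at the identity.
The order on `ℂ` makes `0 ≤ z` mean that `z` is real and nonnegative. -/
structure IsState (ρ : StrongDual ℂ A) : Prop where
  nonneg : ∀ a : A, 0 ≤ ρ (star a * a)
  map_one : ρ 1 = 1

/-- A functional is faithful if it vanishes at no positive element other than zero. -/
def IsFaithful (ρ : StrongDual ℂ A) : Prop :=
  ∀ a : A, ρ (star a * a) = 0 → star a * a = 0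

/-- The action of an invertible element `g` on states,
`c ↦ ρ (g† c g) / ρ (g† g)`. -/
def act (g : Aˣ) (ρ : StrongDual ℂ A) : StrongDual ℂ A :=
  (ρ (star (g : A) * g))⁻¹ •
    (ρ ∘L (ContinuousLinearMap.mul ℂ A (star (g : A))) ∘L
      ((ContinuousLinearMap.mul ℂ A).flip (g : A)))

lemma act_apply (g : Aˣ) (ρ : StrongDual ℂ A) (c : A) :
    act g ρ c = ρ (star (g : A) * c * g) / ρ (star (g : A) * g) := by
  simp [act, mul_assoc, div_eq_inv_mul]

/-- An orbit, in the space of states, of the group of invertible elements. -/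
def IsOrbit (O : Set (StrongDual ℂ A)) : Prop :=
  ∃ ρ : StrongDual ℂ A, IsState ρ ∧ O = Set.range fun g : Aˣ => act g ρ

/-- The value at `ρ` of the gradient vector field of the self-adjoint element `a`, as a functional:
`c ↦ ρ {a, c} - ρ a * ρ c`, with the Jordan product `{a, c} = (a c + c a) / 2`. -/
def gradient (ρ : StrongDual ℂ A) : selfAdjoint A →ₗ[ℝ] StrongDual ℂ A where
  toFun a := (1 / 2 : ℂ) • (ρ ∘L (ContinuousLinearMap.mul ℂ A (a : A)) +
      ρ ∘L ((ContinuousLinearMap.mul ℂ A).flip (a : A))) - ρ (a : A) • ρ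
  map_add' a b := by
    ext c
    simp [add_mul]
    ring
  map_smul' r a := by
    ext c
    have h : ρ (r • (a : A)) = r • ρ (a : A) := by
      rw [← Complex.coe_smul r (a : A), map_smul, Complex.coe_smul]
    have h1 : ρ (r • ((a : A) * c)) = r • ρ ((a : A) * c) := by
      rw [← Complex.coe_smul r, map_smul, Complex.coe_smul]
    have h2 : ρ (r • (c * (a : A))) = r • ρ (c * (a : A)) := by
      rw [← Complex.coe_smul r, map_smul, Complex.coe_smul]
    simp [h]
    ring

lemma gradient_apply (ρ : StrongDual ℂ A) (a : selfAdjoint A) (c : A) :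
    gradient ρ a c = ρ ((1 / 2 : ℂ) • ((a : A) * c + c * (a : A))) - ρ (a : A) * ρ c := by
  simp [gradient]

/-- The tangent space at `ρ` of the orbit through `ρ`, as a space of functionals: it is spanned by
the values of the gradient vector fields. -/
def orbitTangent (ρ : StrongDual ℂ A) : Submodule ℝ (StrongDual ℂ A) :=
  LinearMap.range (gradient ρ)

/-- The form `(a, b) ↦ ρ {a, b} - ρ a * ρ b` on self-adjoint elements (its values are real
when `ρ` is a state). -/
def jordanCov (ρ : StrongDual ℂ A) : LinearMap.BilinForm ℝ (selfAdjoint A) :=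
  LinearMap.mk₂ ℝ
    (fun a b => (gradient ρ a (b : A)).re)
    (fun a a' b => by simp)
    (fun r a b => by simp)
    (fun a b b' => by simp)
    (fun r a b => by
      have h : gradient ρ a (r • (b : A)) = r • gradient ρ a (b : A) := by
        rw [← Complex.coe_smul r (b : A), map_smul, Complex.coe_smul]
      simp [h])

lemma jordanCov_apply (ρ : StrongDual ℂ A) (a b : selfAdjoint A) :
    jordanCov ρ a b =
      (ρ ((1 / 2 : ℂ) • ((a : A) * (b : A) + (b : A) * (a : A))) - ρ (a : A) * ρ (b : A)).re := by
  simp [jordanCov, gradient_apply]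

lemma jordanCov_symm (ρ : StrongDual ℂ A) (a b : selfAdjoint A) :
    jordanCov ρ a b = jordanCov ρ b a := by
  rw [jordanCov_apply, jordanCov_apply, add_comm, mul_comm (ρ (a : A))]

lemma exists_sld (ρ : StrongDual ℂ A) :
    ∃ s : orbitTangent ρ →ₗ[ℝ] selfAdjoint A,
      (gradient ρ).rangeRestrict ∘ₗ s = LinearMap.id := by
  have : Module.Projective ℝ (LinearMap.range (gradient ρ)) := by
    have := Module.Free.of_divisionRing ℝ (LinearMap.range (gradient ρ))
    exact Module.Projective.of_free
  exact (gradient ρ).rangeRestrict.exists_rightInverse_of_surjective (LinearMap.range_rangeRestrict _)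

/-- A choice, linear in `V`, of a self-adjoint element `a` whose gradient vector at `ρ` is `V`
(a symmetric logarithmic derivative of `V`). -/
def sld (ρ : StrongDual ℂ A) : orbitTangent ρ →ₗ[ℝ] selfAdjoint A :=
  (exists_sld ρ).choose

lemma gradient_sld (ρ : StrongDual ℂ A) (V : orbitTangent ρ) :
    gradient ρ (sld ρ V) = V := by
  have h := LinearMap.congr_fun (exists_sld ρ).choose_spec V
  exact congrArg Subtype.val h

/-- The Riemannian metric of the orbit at `ρ`: the value at a pair of gradient vectors of
`a` and `b` is `ρ {a, b} - ρ a * ρ b`, for any `a` and `b`, by `orbitMetric_gradient`. -/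
def orbitMetric (ρ : StrongDual ℂ A) : LinearMap.BilinForm ℝ (orbitTangent ρ) :=
  (jordanCov ρ).compl₁₂ (sld ρ) (sld ρ)

lemma orbitMetric_gradient (ρ : StrongDual ℂ A) (a b : selfAdjoint A) :
    orbitMetric ρ ⟨gradient ρ a, a, rfl⟩ ⟨gradient ρ b, b, rfl⟩ =
      (ρ ((1 / 2 : ℂ) • ((a : A) * (b : A) + (b : A) * (a : A))) - ρ (a : A) * ρ (b : A)).re := by
  set V : orbitTangent ρ := ⟨gradient ρ a, a, rfl⟩
  set W : orbitTangent ρ := ⟨gradient ρ b, b, rfl⟩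
  have h1 : jordanCov ρ (sld ρ V) (sld ρ W) = jordanCov ρ a (sld ρ W) := by
    simp only [jordanCov, LinearMap.mk₂_apply, gradient_sld]
    rfl
  have h2 : jordanCov ρ (sld ρ W) a = jordanCov ρ b a := by
    simp only [jordanCov, LinearMap.mk₂_apply, gradient_sld]
    rfl
  rw [← jordanCov_apply]
  change jordanCov ρ (sld ρ V) (sld ρ W) = _
  rw [h1, jordanCov_symm, h2, jordanCov_symm]

/-! Elementary facts on states. -/

lemma exists_pos_sub_pos (a : A) (ha : IsSelfAdjoint a) :
    ∃ p q : A, IsSelfAdjoint p ∧ IsSelfAdjoint q ∧ (∃ x, p = star x * x) ∧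
      (∃ x, q = star x * x) ∧ a = p - q ∧ p * q = 0 ∧ q * p = 0 := by
  let _ := CStarAlgebra.spectralOrder A
  have _ := CStarAlgebra.spectralOrderedRing A
  refine ⟨a⁺, a⁻, ?_, ?_, ?_, ?_, ?_, ?_, ?_⟩
  · exact .of_nonneg (CFC.posPart_nonneg a)
  · exact .of_nonneg (CFC.negPart_nonneg a)
  · exact CStarAlgebra.nonneg_iff_eq_star_mul_self.1 (CFC.posPart_nonneg a)
  · exact CStarAlgebra.nonneg_iff_eq_star_mul_self.1 (CFC.negPart_nonneg a)
  · exact (CFC.posPart_sub_negPart a ha).symm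
  · exact CFC.posPart_mul_negPart a
  · exact CFC.negPart_mul_posPart a

lemma IsState.im_eq_zero {ρ : StrongDual ℂ A} (h : IsState ρ) {a : A} (ha : IsSelfAdjoint a) :
    (ρ a).im = 0 := by
  obtain ⟨p, q, -, -, ⟨x, hx⟩, ⟨y, hy⟩, rfl, -, -⟩ := exists_pos_sub_pos a ha
  have h1 := (Complex.le_def.1 (h.nonneg x)).2
  have h2 := (Complex.le_def.1 (h.nonneg y)).2
  rw [← hx] at h1
  rw [← hy] at h2
  simp at h1 h2
  simp [← h1, ← h2]

/-- Vanishing of the second moment of a self-adjoint element forces that of the first. -/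
lemma IsState.eq_zero_of_sq {ρ : StrongDual ℂ A} (h : IsState ρ) {a : A} (ha : IsSelfAdjoint a)
    (h0 : ρ (a * a) = 0) : ρ a = 0 := by
  have him := h.im_eq_zero ha
  have hr : ρ a = ((ρ a).re : ℂ) := by
    apply Complex.ext <;> simp [him]
  set t := (ρ a).re
  have h1 := h.nonneg (a - (t : ℂ) • 1)
  have h2 : star (a - (t : ℂ) • (1 : A)) * (a - (t : ℂ) • 1) =
      a * a - (2 * t : ℂ) • a + (t * t : ℂ) • 1 := by
    rw [star_sub, ha.star_eq, star_smul, star_one]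
    simp only [Complex.star_def, Complex.conj_ofReal, sub_mul, mul_sub, smul_mul_assoc, one_mul,
      mul_smul_comm, mul_one]
    module
  rw [h2] at h1
  simp only [map_add, map_sub, map_smul, h0, hr, h.map_one, smul_eq_mul] at h1
  have h3 := (Complex.le_def.1 h1).1
  simp at h3
  have : t = 0 := by nlinarith
  rw [hr, this]
  simp

lemma IsState.act {ρ : StrongDual ℂ A} (h : IsState ρ) (g : Aˣ) : IsState (act g ρ) := by
  have hne : ρ (star (g : A) * g) ≠ 0 := by
    let _ := CStarAlgebra.spectralOrder A
    have _ := CStarAlgebra.spectralOrderedRing A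
    intro h0
    set k : A := ((g⁻¹ : Aˣ) : A)
    have hk : star k * k ≤ algebraMap ℝ A (‖k‖ ^ 2) := CStarAlgebra.star_mul_le_algebraMap_norm_sq
    have hk2 := star_left_conjugate_le_conjugate hk (g : A)
    have e1 : star (g : A) * (star k * k) * g = 1 := by
      have : k * (g : A) = 1 := g.inv_mul
      calc star (g : A) * (star k * k) * g = star (k * g) * (k * g) := by
            simp [star_mul, mul_assoc]
        _ = 1 := by simp [this]
    have e2 : star (g : A) * algebraMap ℝ A (‖k‖ ^ 2) * g =
        ((‖k‖ ^ 2 : ℝ) : ℂ) • (star (g : A) * g) := by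
      rw [Algebra.algebraMap_eq_smul_one, mul_smul_comm, mul_one, smul_mul_assoc,
        Complex.coe_smul]
    rw [e1, e2] at hk2
    obtain ⟨x, hx⟩ := CStarAlgebra.nonneg_iff_eq_star_mul_self.1 (sub_nonneg.2 hk2)
    have h3 := h.nonneg x
    rw [← hx, map_sub, map_smul, h0, h.map_one] at h3
    have h4 := (Complex.le_def.1 h3).1
    norm_num at h4
  refine ⟨fun a => ?_, ?_⟩
  · rw [act_apply]
    have e : star (g : A) * (star a * a) * g = star (a * g) * (a * g) := by
      simp [star_mul, mul_assoc]
    rw [e]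
    exact div_nonneg (h.nonneg _) (h.nonneg _)
  · rw [act_apply, mul_one, div_self hne]

lemma IsOrbit.isState {O : Set (StrongDual ℂ A)} (hO : IsOrbit O) {ρ : StrongDual ℂ A}
    (hρ : ρ ∈ O) : IsState ρ := by
  obtain ⟨σ, hσ, rfl⟩ := hO
  obtain ⟨g, rfl⟩ := hρ
  exact hσ.act g

lemma finiteDimensional_selfAdjoint [FiniteDimensional ℂ A] :
    FiniteDimensional ℝ (selfAdjoint A) := by
  have : FiniteDimensional ℝ A := FiniteDimensional.complexToReal A
  exact FiniteDimensional.of_injective (selfAdjoint.submodule ℝ A).subtype Subtype.val_injective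

/-- A functional that is real on self-adjoint elements, and vanishes at the identity and at the
positive elements where the state `ρ` vanishes, is a gradient vector at `ρ`. -/
lemma mem_orbitTangent [FiniteDimensional ℂ A] {ρ : StrongDual ℂ A} (h : IsState ρ)
    (V : StrongDual ℂ A) (h_im : ∀ c : A, IsSelfAdjoint c → (V c).im = 0) (h_one : V 1 = 0)
    (h_zero : ∀ x : A, ρ (star x * x) = 0 → V (star x * x) = 0) : V ∈ orbitTangent ρ := by
  have := finiteDimensional_selfAdjoint (A := A)
  have hsm : ∀ (W : StrongDual ℂ A) (r : ℝ) (b : A), W (r • b) = r • W b := by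
    intro W r b
    rw [← Complex.coe_smul r b, map_smul, Complex.coe_smul]
  let B : selfAdjoint A →ₗ[ℝ] Module.Dual ℝ (selfAdjoint A) :=
    LinearMap.mk₂ ℝ
      (fun a b => (ρ ((1 / 2 : ℂ) • ((a : A) * (b : A) + (b : A) * (a : A)))).re)
      (fun a a' b => by simp [add_mul, mul_add]; ring)
      (fun r a b => by simp [hsm]; ring)
      (fun a b b' => by simp [add_mul, mul_add]; ring)
      (fun r a b => by simp [hsm]; ring)
  let f : Module.Dual ℝ (selfAdjoint A) :=
    { toFun := fun c => (V (c : A)).re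
      map_add' := fun c d => by simp
      map_smul' := fun r c => by simp [hsm] }
  have hB : ∀ a b : selfAdjoint A, B a b =
    (ρ ((1 / 2 : ℂ) • ((a : A) * (b : A) + (b : A) * (a : A)))).re := fun a b => rfl
  have hf : ∀ c : selfAdjoint A, f c = (V (c : A)).re := fun c => rfl
  have hmem : f ∈ (LinearMap.ker B).dualAnnihilator := by
    rw [Submodule.mem_dualAnnihilator]
    intro a ha
    have h1 : B a a = 0 := by rw [LinearMap.mem_ker.1 ha]; rfl
    obtain ⟨p, q, hp, hq, ⟨x, hx⟩, ⟨y, hy⟩, hpq, h0, h0'⟩ :=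
      exists_pos_sub_pos (a : A) a.2
    have h2 : (a : A) * a = p * p + q * q := by
      rw [hpq, sub_mul, mul_sub, mul_sub, h0, h0']
      simp
    have h3 : (ρ (p * p)).re + (ρ (q * q)).re = 0 := by
      rw [hB] at h1
      have e : (1 / 2 : ℂ) • ((a : A) * (a : A) + (a : A) * (a : A)) = p * p + q * q := by
        rw [h2]; module
      rw [e] at h1
      simpa using h1
    have hpp := h.nonneg p
    have hqq := h.nonneg q
    rw [hp.star_eq] at hpp
    rw [hq.star_eq] at hqq
    have hp1 := Complex.le_def.1 hpp
    have hq1 := Complex.le_def.1 hqq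
    simp only [Complex.zero_re, Complex.zero_im] at hp1 hq1
    have hp2 : ρ (p * p) = 0 := Complex.ext (by simp; linarith) (by simp [← hp1.2])
    have hq2 : ρ (q * q) = 0 := Complex.ext (by simp; linarith) (by simp [← hq1.2])
    have hp3 := h.eq_zero_of_sq hp hp2
    have hq3 := h.eq_zero_of_sq hq hq2
    have hp4 : V p = 0 := by rw [hx] at hp3 ⊢; exact h_zero x hp3
    have hq4 : V q = 0 := by rw [hy] at hq3 ⊢; exact h_zero y hq3
    rw [hf, hpq, map_sub, hp4, hq4]
    simp
  rw [← LinearMap.range_dualMap_eq_dualAnnihilator_ker] at hmem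
  obtain ⟨φ, hφ⟩ := hmem
  obtain ⟨a, rfl⟩ := (Module.evalEquiv ℝ (selfAdjoint A)).surjective φ
  have hfa : ∀ c : selfAdjoint A, f c = B a c := by
    intro c
    rw [← hφ, hB]
    simp [LinearMap.dualMap_apply, hB, add_comm]
  have ha0 : ρ (a : A) = 0 := by
    have h1 := hfa 1
    rw [hB, hf] at h1
    have e : (1 / 2 : ℂ) • ((a : A) * ((1 : selfAdjoint A) : A) +
        ((1 : selfAdjoint A) : A) * (a : A)) = a := by
      simp only [selfAdjoint.val_one, mul_one, one_mul]
      module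
    rw [e] at h1
    simp only [selfAdjoint.val_one, h_one, Complex.zero_re] at h1
    exact Complex.ext h1.symm (h.im_eq_zero a.2)
  refine ⟨a, ?_⟩
  have key : ∀ c : A, IsSelfAdjoint c → gradient ρ a c = V c := by
    intro c hc
    rw [gradient_apply, ha0, zero_mul, sub_zero]
    apply Complex.ext
    · exact (hfa ⟨c, hc⟩).symm
    · rw [h_im c hc]
      apply h.im_eq_zero
      have ha : star (a : A) = a := a.2.star_eq
      rw [isSelfAdjoint_iff, star_smul, star_add, star_mul, star_mul, ha, hc.star_eq, add_comm]
      simp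
  ext c
  have hc := realPart_add_I_smul_imaginaryPart c
  rw [← hc, map_add, map_add, map_smul, map_smul, key _ (realPart c).2, key _ (imaginaryPart c).2]

end States

/-! ### Parametric models and their pullback metric -/

section Models

/-- A parametric model of states on `A`: an orbit of states and a smooth map of the manifold `M`
into it. The orbit is an embedded submanifold of the dual space of `A`, so smoothness
is smoothness as a map into the dual space. -/
structure ParametricModel (E M A : Type*) [NormedAddCommGroup E] [NormedSpace ℝ E]
    [TopologicalSpace M] [ChartedSpace E M] [CStarAlgebra A] where
  /-- the map of `M` into the states -/
  toFun : M → StrongDual ℂ A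
  /-- the orbit -/
  orbit : Set (StrongDual ℂ A)
  isOrbit : IsOrbit orbit
  mem_orbit : ∀ m, toFun m ∈ orbit
  smooth : ContMDiff 𝓘(ℝ, E) 𝓘(ℝ, StrongDual ℂ A) ∞ toFun

variable {E M A : Type*} [NormedAddCommGroup E] [NormedSpace ℝ E]
  [TopologicalSpace M] [ChartedSpace E M] [CStarAlgebra A]

lemma ParametricModel.isState (P : ParametricModel E M A) (m : M) : IsState (P.toFun m) :=
  P.isOrbit.isState (P.mem_orbit m)

/-- The differential of the map of a parametric model takes values in the tangent spaces
of the orbit. -/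
lemma ParametricModel.mfderiv_mem [FiniteDimensional ℂ A] (P : ParametricModel E M A) (m : M)
    (v : TangentSpace 𝓘(ℝ, E) m) :
    (mfderiv 𝓘(ℝ, E) 𝓘(ℝ, StrongDual ℂ A) P.toFun m v : StrongDual ℂ A) ∈
      orbitTangent (P.toFun m) := by
  have hd : MDifferentiableAt 𝓘(ℝ, E) 𝓘(ℝ, StrongDual ℂ A) P.toFun m :=
    (P.smooth m).mdifferentiableAt (by simp)
  set F : E → StrongDual ℂ A := fun y => P.toFun ((extChartAt 𝓘(ℝ, E) m).symm y) with hF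
  set y₀ : E := extChartAt 𝓘(ℝ, E) m m with hy₀
  have hFy : F y₀ = P.toFun m := by simp [hF, hy₀]
  have hFs : ∀ y, IsState (F y) := fun y => P.isState _
  have hdF : DifferentiableAt ℝ F y₀ := by
    have := hd.differentiableWithinAt_writtenInExtChartAt
    simp only [writtenInExtChartAt, extChartAt_model_space_eq_id, modelWithCornersSelf_coe,
      Set.range_id, differentiableWithinAt_univ] at this
    exact this
  have hmf : mfderiv 𝓘(ℝ, E) 𝓘(ℝ, StrongDual ℂ A) P.toFun m = fderiv ℝ F y₀ := by
    rw [hd.mfderiv]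
    simp [writtenInExtChartAt, Function.comp_def, hF, hy₀]
    rfl
  rw [hmf]
  let ev : A → StrongDual ℂ A →L[ℝ] ℂ := fun c =>
    (ContinuousLinearMap.apply ℂ ℂ c).restrictScalars ℝ
  have hev : ∀ c, HasFDerivAt (fun y => F y c) ((ev c).comp (fderiv ℝ F y₀)) y₀ := fun c =>
    (ev c).hasFDerivAt.comp y₀ hdF.hasFDerivAt
  have hval : ∀ c, fderiv ℝ F y₀ v c = ((ev c).comp (fderiv ℝ F y₀)) v := fun c => rfl
  have h_im : ∀ c : A, IsSelfAdjoint c → (fderiv ℝ F y₀ v c).im = 0 := by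
    intro c hc
    have h1 := Complex.imCLM.hasFDerivAt.comp y₀ (hev c)
    have h2 : (Complex.imCLM ∘ fun y => F y c) = fun _ => (0 : ℝ) := by
      funext y
      exact (hFs y).im_eq_zero hc
    rw [h2] at h1
    have h3 := h1.unique (hasFDerivAt_const (0 : ℝ) y₀)
    exact congrArg (fun L => L v) h3
  refine mem_orbitTangent (P.isState m) _ h_im ?_ ?_
  · have h2 : (fun y => F y 1) = fun _ => (1 : ℂ) := by
      funext y
      exact (hFs y).map_one
    have h1 := hev 1
    rw [h2] at h1
    have h3 := h1.unique (hasFDerivAt_const (1 : ℂ) y₀)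
    exact congrArg (fun L => L v) h3
  · intro x hx
    have h1 := Complex.reCLM.hasFDerivAt.comp y₀ (hev (star x * x))
    have hmin : IsLocalMin (Complex.reCLM ∘ fun y => F y (star x * x)) y₀ := by
      refine Filter.Eventually.of_forall fun y => ?_
      have hy := (Complex.le_def.1 ((hFs y).nonneg x)).1
      simpa [hFy, hx] using hy
    have h3 := hmin.hasFDerivAt_eq_zero h1
    refine Complex.ext ?_ (h_im _ (IsSelfAdjoint.star_mul_self x))
    exact congrArg (fun L => L v) h3

/-- The differential of the map of a parametric model, into the tangent space of the orbit. -/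
def ParametricModel.tangentMap [FiniteDimensional ℂ A] (P : ParametricModel E M A) (m : M) :
    TangentSpace 𝓘(ℝ, E) m →ₗ[ℝ] orbitTangent (P.toFun m) where
  toFun v := ⟨mfderiv 𝓘(ℝ, E) 𝓘(ℝ, StrongDual ℂ A) P.toFun m v, P.mfderiv_mem m v⟩
  map_add' v w := Subtype.ext
    ((mfderiv 𝓘(ℝ, E) 𝓘(ℝ, StrongDual ℂ A) P.toFun m).map_add v w)
  map_smul' r v := Subtype.ext
    ((mfderiv 𝓘(ℝ, E) 𝓘(ℝ, StrongDual ℂ A) P.toFun m).map_smul r v)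

/-- The pullback to `M` of the Riemannian metric of the orbit. -/
def ParametricModel.metric [FiniteDimensional ℂ A] (P : ParametricModel E M A) (m : M) :
    LinearMap.BilinForm ℝ (TangentSpace 𝓘(ℝ, E) m) :=
  (orbitMetric (P.toFun m)).compl₁₂ (P.tangentMap m) (P.tangentMap m)

end Models

/-! ### Measurement procedures and parametric statistical models -/

section Measurement

/-- A measurement procedure with outcome space `X`: a positive unital linear map from the
algebra of complex functions on `X` to `A`. -/
structure IsMeasurement {X A : Type*} [Fintype X] [CStarAlgebra A]
    (μ : (X → ℂ) →L[ℂ] A) : Prop where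
  map_one : μ 1 = 1
  pos : ∀ f : X → ℂ, ∃ a : A, μ (star f * f) = star a * a

/-- The open simplex: the faithful states on the algebra of complex functions on `X`. -/
def openSimplex (X : Type*) [Fintype X] : Set (StrongDual ℂ (X → ℂ)) :=
  {p | IsState p ∧ IsFaithful p}

/-- The open simplex is an orbit: the one through the uniform distribution. -/
lemma isOrbit_openSimplex (X : Type*) [Fintype X] [Nonempty X] : IsOrbit (openSimplex X) := by
  classical
  let n : ℂ := Fintype.card X
  have hn : 0 < n := by
    have : 0 < Fintype.card X := Fintype.card_pos
    exact Nat.cast_pos.2 this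
  let u : StrongDual ℂ (X → ℂ) := n⁻¹ • ∑ x : X, ContinuousLinearMap.proj x
  have hu : ∀ f : X → ℂ, u f = n⁻¹ * ∑ x, f x := by
    intro f
    simp [u]
  have hus : IsState u := by
    refine ⟨fun a => ?_, ?_⟩
    · rw [hu]
      refine mul_nonneg (inv_nonneg.2 hn.le) (Finset.sum_nonneg fun x _ => ?_)
      exact star_mul_self_nonneg (a x)
    · rw [hu]
      simp [n]
  refine ⟨u, hus, Set.ext fun p => ⟨?_, ?_⟩⟩
  · rintro ⟨hp, hf⟩
    have hsingle : ∀ x : X, (Pi.single x 1 : X → ℂ) =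
        star (Pi.single x 1 : X → ℂ) * Pi.single x 1 := by
      intro x
      ext y
      by_cases h : y = x
      · subst h; simp
      · simp [h]
    have hpos : ∀ x : X, 0 ≤ p (Pi.single x 1) := by
      intro x
      rw [hsingle x]
      exact hp.nonneg _
    have hne : ∀ x : X, p (Pi.single x 1) ≠ 0 := by
      intro x h0
      have h1 := hf (Pi.single x 1)
      rw [← hsingle x] at h1
      have h2 := congrFun (h1 h0) x
      simp at h2
    have hreal : ∀ x : X, ((p (Pi.single x 1)).re : ℂ) = p (Pi.single x 1) := by
      intro x
      apply Complex.ext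
      · simp
      · have := (Complex.le_def.1 (hpos x)).2
        simpa using this
    have hre : ∀ x : X, 0 < (p (Pi.single x 1)).re := by
      intro x
      have h1 := (Complex.le_def.1 (hpos x)).1
      refine lt_of_le_of_ne h1 fun h2 => hne x ?_
      rw [← hreal x, ← h2]
      simp
    have hsum : ∀ f : X → ℂ, p f = ∑ x, f x * p (Pi.single x 1) := by
      intro f
      have h1 : f = ∑ x, f x • (Pi.single x 1 : X → ℂ) := pi_eq_sum_univ' f
      conv_lhs => rw [h1]
      simp [map_sum]
    let r : X → ℂ := fun x => (Real.sqrt (p (Pi.single x 1)).re : ℂ)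
    have hr : ∀ x, r x * r x = p (Pi.single x 1) := by
      intro x
      rw [← hreal x, ← Complex.ofReal_mul, Real.mul_self_sqrt (hre x).le]
    have hr0 : ∀ x, r x ≠ 0 := fun x h => hne x (by rw [← hr x, h, zero_mul])
    have hrs : ∀ x, star (r x) = r x := fun x => Complex.conj_ofReal _
    let g : (X → ℂ)ˣ := ⟨r, fun x => (r x)⁻¹, by
      ext x; simp [hr0 x], by ext x; simp [hr0 x]⟩
    refine ⟨g, ?_⟩
    have key : ∀ c : X → ℂ, u (star (g : X → ℂ) * c * g) = n⁻¹ * p c := by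
      intro c
      rw [hu, hsum c]
      congr 1
      refine Finset.sum_congr rfl fun x _ => ?_
      change star (r x) * c x * r x = _
      rw [hrs, ← hr x]
      ring
    ext c
    rw [act_apply, key]
    have h1 := key 1
    rw [mul_one, hp.map_one] at h1
    rw [h1]
    have : n ≠ 0 := hn.ne'
    field_simp
  · rintro ⟨g, rfl⟩
    have hst := hus.act g
    refine ⟨hst, fun a ha => ?_⟩
    have hne : u (star (g : X → ℂ) * g) ≠ 0 := by
      intro h0
      have h1 := hst.map_one
      rw [act_apply, h0, div_zero] at h1
      exact zero_ne_one h1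
    dsimp only at ha
    rw [act_apply, div_eq_zero_iff, or_iff_left hne, hu, mul_eq_zero,
      or_iff_right (inv_ne_zero hn.ne'),
      Finset.sum_eq_zero_iff_of_nonneg] at ha
    · ext x
      have h1 := ha x (Finset.mem_univ x)
      have hg : (g : X → ℂ) x ≠ 0 := by
        intro h0
        have h2 := congrFun g.mul_inv x
        simp [h0] at h2
      simpa [hg] using h1
    · intro x _
      have e : (star (g : X → ℂ) * (star a * a) * g) x =
          star (a x * (g : X → ℂ) x) * (a x * (g : X → ℂ) x) := by
        simp
        ring
      rw [e]
      exact star_mul_self_nonneg _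

variable {E M A X : Type*} [NormedAddCommGroup E] [NormedSpace ℝ E]
  [TopologicalSpace M] [ChartedSpace E M] [CStarAlgebra A] [Fintype X]

/-- The measurement procedure `μ` is regular for the model `P`: the map
`m ↦ (P.toFun m) ∘ μ` takes values in the open simplex. -/
def ParametricModel.IsRegular (P : ParametricModel E M A) (μ : (X → ℂ) →L[ℂ] A) : Prop :=
  ∀ m, (P.toFun m) ∘L μ ∈ openSimplex X

/-- The parametric statistical model associated with `P` by a regular measurement procedure `μ`:
the model `m ↦ (P.toFun m) ∘ μ` in the open simplex. -/
def ParametricModel.statisticalModel [Nonempty X] (P : ParametricModel E M A)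
    (μ : (X → ℂ) →L[ℂ] A) (hμ : P.IsRegular μ) : ParametricModel E M (X → ℂ) where
  toFun m := (P.toFun m) ∘L μ
  orbit := openSimplex X
  isOrbit := isOrbit_openSimplex X
  mem_orbit := hμ
  smooth := by
    let L : StrongDual ℂ A →L[ℝ] StrongDual ℂ (X → ℂ) :=
      ((ContinuousLinearMap.compL ℂ (X → ℂ) A ℂ).flip μ).restrictScalars ℝ
    exact L.contMDiff.comp P.smooth

end Measurement

/-! ### Estimators -/

section Estimation

/-- Invertibility of a bilinear form `B`: the map `v ↦ B v` into the dual space is bijective. -/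
def IsInvertible {V : Type*} [AddCommGroup V] [Module ℝ V] (B : LinearMap.BilinForm ℝ V) : Prop :=
  Function.Bijective B

/-- The inverse of the map `v ↦ B v` of a vector space into its dual. -/
def sharp {V : Type*} [AddCommGroup V] [Module ℝ V] (B : LinearMap.BilinForm ℝ V)
    (hB : IsInvertible B) : Module.Dual ℝ V →ₗ[ℝ] V :=
  (LinearEquiv.ofBijective B hB).symm

/-- The inverse of an invertible bilinear form, a bilinear form on covectors. -/
def inverseForm {V : Type*} [AddCommGroup V] [Module ℝ V] (B : LinearMap.BilinForm ℝ V)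
    (hB : IsInvertible B) : LinearMap.BilinForm ℝ (Module.Dual ℝ V) :=
  B.compl₁₂ (sharp B hB) (sharp B hB)

variable {E M X : Type*} [NormedAddCommGroup E] [NormedSpace ℝ E]
  [TopologicalSpace M] [ChartedSpace E M] [Fintype X] [DecidableEq X]

variable (E) in
/-- A cost function: smooth, nonnegative, and zero exactly on the diagonal. -/
structure IsCostFunction (C : M → M → ℝ) : Prop where
  smooth : ContMDiff (𝓘(ℝ, E).prod 𝓘(ℝ, E)) 𝓘(ℝ, ℝ) ∞ fun q : M × M => C q.1 q.2
  nonneg : ∀ m₁ m₂, 0 ≤ C m₁ m₂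
  eq_zero_iff : ∀ m₁ m₂, C m₁ m₂ = 0 ↔ m₁ = m₂

/-- The probability of the outcome `x` at the parameter `m`. -/
def ParametricModel.prob (Q : ParametricModel E M (X → ℂ)) (m : M) (x : X) : ℝ :=
  (Q.toFun m (Pi.single x 1)).re

/-- The function `L (m₁, m₂)`: the expected cost at `m₁` of the estimator `est`, under the
probability distribution with parameter `m₂`. -/
def loss (Q : ParametricModel E M (X → ℂ)) (C : M → M → ℝ) (est : X → M) (m₁ m₂ : M) : ℝ :=
  ∑ x, C m₁ (est x) * Q.prob m₂ x

/-- The differential at `m` of a real function on `M`. -/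
def differential (f : M → ℝ) (m : M) : Module.Dual ℝ (TangentSpace 𝓘(ℝ, E) m) :=
  (mfderiv 𝓘(ℝ, E) 𝓘(ℝ, ℝ) f m).toLinearMap

/-- The estimator is stationary at `m`: the differential at `m` of `L (·, m)` is zero. -/
def IsStationary (Q : ParametricModel E M (X → ℂ)) (C : M → M → ℝ) (est : X → M) (m : M) :
    Prop :=
  differential (E := E) (fun m₁ => loss Q C est m₁ m) m = 0

/-- The second derivative at `m` of `f` read in the preferred chart at `m`; the tangent space
at `m` is identified with `E` by the same chart. At a critical point of a smooth `f` this is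
the Hessian form `(Y m, X m) ↦ (Y (X f)) m`, by `hessian_eq`. -/
def hessian (f : M → ℝ) (m : M) : LinearMap.BilinForm ℝ (TangentSpace 𝓘(ℝ, E) m) :=
  (fderiv ℝ (fderiv ℝ fun y : E => f ((extChartAt 𝓘(ℝ, E) m).symm y))
    (extChartAt 𝓘(ℝ, E) m m)).toBilinForm

/-- At a critical point `m` of a smooth `f`, the form `hessian f m` takes the value
`(Y (X f)) m` at the values at `m` of vector fields `Y` and `X`. -/
lemma hessian_eq [IsManifold 𝓘(ℝ, E) ∞ M] {f : M → ℝ} (hf : ContMDiff 𝓘(ℝ, E) 𝓘(ℝ, ℝ) ∞ f)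
    {m : M} (hm : differential (E := E) f m = 0) (Y V : ∀ p : M, TangentSpace 𝓘(ℝ, E) p)
    (hV : MDifferentiableAt 𝓘(ℝ, E) 𝓘(ℝ, E).tangent
      (fun p => (⟨p, V p⟩ : TangentBundle 𝓘(ℝ, E) M)) m) :
    differential (fun p => differential f p (V p)) m (Y m) = hessian f m (Y m) (V m) := by
  have : IsManifold 𝓘(ℝ, E) 1 M := IsManifold.of_le (n := ∞) (by simp)
  set F : E → ℝ := fun y => f ((extChartAt 𝓘(ℝ, E) m).symm y) with hF
  set φ := extChartAt 𝓘(ℝ, E) m with hφ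
  let V' : M → E := fun p => (trivializationAt E (TangentSpace 𝓘(ℝ, E)) m ⟨p, V p⟩).2
  have hFs : ContDiffOn ℝ ∞ F φ.target := by
    have h := hf.comp_contMDiffOn (contMDiffOn_extChartAt_symm (I := 𝓘(ℝ, E)) (n := ∞) m)
    exact h.contDiffOn
  have hy₀ : φ m ∈ φ.target := mem_extChartAt_target m
  have htn : φ.target ∈ 𝓝 (φ m) := extChartAt_target_mem_nhds m
  have hFd : ∀ y ∈ φ.target, DifferentiableAt ℝ F y := fun y hy =>
    (hFs.contDiffAt ((isOpen_extChartAt_target m).mem_nhds hy)).differentiableAt (by simp)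
  have hF2 : DifferentiableAt ℝ (fderiv ℝ F) (φ m) :=
    ((hFs.contDiffAt htn).fderiv_right (m := 1) (by norm_cast)).differentiableAt (by simp)
  have hmd : ∀ g : M → ℝ, MDifferentiableAt 𝓘(ℝ, E) 𝓘(ℝ, ℝ) g m →
      ∀ v : TangentSpace 𝓘(ℝ, E) m,
      differential g m v = fderiv ℝ (fun y => g (φ.symm y)) (φ m) v := by
    intro g hg v
    change mfderiv 𝓘(ℝ, E) 𝓘(ℝ, ℝ) g m v = _
    rw [hg.mfderiv]
    simp [writtenInExtChartAt, Function.comp_def, hφ]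
    rfl
  have hFm : fderiv ℝ F (φ m) = 0 := by
    ext v
    rw [← hmd f ((hf m).mdifferentiableAt (by simp)) v, hm]
    rfl
  have hV' : MDifferentiableAt 𝓘(ℝ, E) 𝓘(ℝ, E) V' m :=
    (mdifferentiableAt_section 𝓘(ℝ, E) V).1 hV
  have hcla : ∀ p ∈ (chartAt E m).source,
      V' p = mfderiv 𝓘(ℝ, E) 𝓘(ℝ, E) φ p (V p) := by
    intro p hp
    have h := TangentBundle.continuousLinearMapAt_trivializationAt (I := 𝓘(ℝ, E)) hp
    have h2 := Bundle.Trivialization.continuousLinearMapAt_apply_of_mem (R := ℝ)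
      (trivializationAt E (TangentSpace 𝓘(ℝ, E)) m) (b := p) (by simpa using hp) (V p)
    exact h2.symm.trans (congrArg (fun L => L (V p)) h)
  have hVm : V' m = V m := by
    have h := (tangentBundleCore 𝓘(ℝ, E) M).coordChange_self (achart E m) m
      (mem_chart_source E m) (V m)
    exact h
  have hchart : ∀ p ∈ (chartAt E m).source, differential f p (V p) = fderiv ℝ F (φ p) (V' p) := by
    intro p hp
    have hp' : p ∈ φ.source := by simpa [hφ] using hp
    have hφp : MDifferentiableAt 𝓘(ℝ, E) 𝓘(ℝ, E) φ p := mdifferentiableAt_extChartAt hp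
    have hFp : MDifferentiableAt 𝓘(ℝ, E) 𝓘(ℝ, ℝ) F (φ p) :=
      (hFd _ (φ.map_source hp')).mdifferentiableAt
    have heq : f =ᶠ[𝓝 p] F ∘ φ := by
      filter_upwards [(chartAt E m).open_source.mem_nhds hp] with q hq
      have hq' : q ∈ φ.source := by simpa [hφ] using hq
      simp [hF, φ.left_inv hq']
    change mfderiv 𝓘(ℝ, E) 𝓘(ℝ, ℝ) f p (V p) = _
    rw [heq.mfderiv_eq, mfderiv_comp p hFp hφp, hcla p hp, mfderiv_eq_fderiv]
    rfl
  let W : E → E := fun y => V' (φ.symm y)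
  have hW : DifferentiableAt ℝ W (φ m) := by
    have h := hV'.differentiableWithinAt_writtenInExtChartAt
    simp only [writtenInExtChartAt, extChartAt_model_space_eq_id, modelWithCornersSelf_coe,
      Set.range_id, differentiableWithinAt_univ] at h
    exact h
  have hsource : (chartAt E m).source ∈ 𝓝 m := chart_source_mem_nhds E m
  have hG : MDifferentiableAt 𝓘(ℝ, E) 𝓘(ℝ, ℝ) (fun p => fderiv ℝ F (φ p) (V' p)) m := by
    have h1 : MDifferentiableAt 𝓘(ℝ, E) 𝓘(ℝ, E →L[ℝ] ℝ) (fun p => fderiv ℝ F (φ p)) m :=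
      hF2.mdifferentiableAt.comp m (mdifferentiableAt_extChartAt (mem_chart_source E m))
    exact h1.clm_apply hV'
  have heq : (fun p => differential f p (V p)) =ᶠ[𝓝 m] fun p => fderiv ℝ F (φ p) (V' p) := by
    filter_upwards [hsource] with p hp using hchart p hp
  have h1 : differential (fun p => differential f p (V p)) m (Y m) =
      differential (fun p => fderiv ℝ F (φ p) (V' p)) m (Y m) := by
    exact congrArg (fun L : E →L[ℝ] ℝ => L (Y m)) heq.mfderiv_eq
  rw [h1, hmd _ hG]
  have heq2 : (fun y => fderiv ℝ F (φ (φ.symm y)) (V' (φ.symm y))) =ᶠ[𝓝 (φ m)]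
      fun y => fderiv ℝ F y (W y) := by
    filter_upwards [htn] with y hy
    rw [φ.right_inv hy]
  rw [heq2.fderiv_eq, fderiv_clm_apply hF2 hW, hFm]
  have hWm : W (φ m) = V m := by
    simp only [W, hφ, extChartAt_to_inv]
    exact hVm
  rw [hWm]
  simp [hessian]
  rfl

/-- The bilinear form `(v, w) ↦ ∑ x, v(C (·, est x)) * w(C (·, est x)) * p x` at `m`. -/
def costForm (Q : ParametricModel E M (X → ℂ)) (C : M → M → ℝ) (est : X → M) (m : M) :
    LinearMap.BilinForm ℝ (TangentSpace 𝓘(ℝ, E) m) :=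
  ∑ x, Q.prob m x • LinearMap.BilinForm.linMulLin
    (differential (fun m₁ => C m₁ (est x)) m) (differential (fun m₁ => C m₁ (est x)) m)

/-- The covariance bivector at `m`: the form `costForm` at the images of the covectors under
the inverse of the Hessian of `L (·, m)` at `m`. -/
def covariance (Q : ParametricModel E M (X → ℂ)) (C : M → M → ℝ) (est : X → M) (m : M)
    (hH : IsInvertible (hessian (E := E) (fun m₁ => loss Q C est m₁ m) m)) :
    LinearMap.BilinForm ℝ (Module.Dual ℝ (TangentSpace 𝓘(ℝ, E) m)) :=
  (costForm Q C est m).compl₁₂ (sharp _ hH) (sharp _ hH)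

end Estimation

end CStarEstimation

end

open CStarEstimation

/-! Both inequalities rest on one Cauchy–Schwarz estimate. At a state `ρ`, a tangent vector `V` of
the orbit is the gradient of its logarithmic derivative, so its value at an observable `b` is the
Jordan covariance of the two, and `V(b)² ≤ G(V,V) · Var(b)`, with equality at the logarithmic
derivative itself (`sq_re_apply_le_orbitMetric_mul`, `re_apply_sld`).

Second inequality. The classical tangent vector is `V ∘ μ`. Its squared norm is attained at a
classical observable `f`, where it equals `V(μ f)`. The Kadison–Schwarz inequality gives `Var(μ f) ≤
Var(f)`, the means being equal, so the classical metric is at most the noncommutative one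
(`ParametricModel.metric_statisticalModel_le`). Inversion reverses the order
(`inverseForm_antitone`).

First inequality. Stationarity near the point says that `∑ p_x dC_x` vanishes identically there,
where `C_x = C(·, est x)`. Differentiating this identity gives `H(u,v) = -∑ dp_x(u) dC_x(v)`
(`hessian_loss_apply`). For `v = H⁻¹ξ` and `u = G⁻¹ξ`, with `G` the classical metric, the left side
is `ξ(u) = G⁻¹(ξ,ξ) = G(u,u)`, and the right side is, up to sign, a classical tangent vector
evaluated at the random variable `x ↦ dC_x(v)`, whose second moment is `Cov(ξ,ξ)`. Cauchy–Schwarz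
yields `G⁻¹(ξ,ξ)² ≤ G⁻¹(ξ,ξ) Cov(ξ,ξ)`. -/

noncomputable section

namespace CStarEstimation

/-! ### Variances and Cauchy–Schwarz on the orbit. -/

section Inequalities

variable {A : Type*} [CStarAlgebra A]

/-- On the diagonal the form is the variance `ρ(a²) - ρ(a)²`, the second moment of the centred
element `a - ρ(a)`. The upper bound drops the squared mean; it serves to compare with the uncentred
covariance of an estimator. -/
lemma IsState.jordanCov_nonneg_and_le {ρ : StrongDual ℂ A} (h : IsState ρ) (a : selfAdjoint A) :
    0 ≤ jordanCov ρ a a ∧ jordanCov ρ a a ≤ (ρ ((a : A) * a)).re := by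
  have him := h.im_eq_zero a.2
  set t := (ρ (a : A)).re
  have hr : ρ (a : A) = (t : ℂ) := by apply Complex.ext <;> simp [t, him]
  have e : (1 / 2 : ℂ) • ((a : A) * a + (a : A) * a) = (a : A) * a := by module
  have hcov : jordanCov ρ a a = (ρ ((a : A) * a)).re - t * t := by
    rw [jordanCov_apply, e, hr]
    simp
  have h1 := h.nonneg ((a : A) - (t : ℂ) • 1)
  have h2 : star ((a : A) - (t : ℂ) • (1 : A)) * (a - (t : ℂ) • 1) =
      (a : A) * a - (2 * t : ℂ) • (a : A) + (t * t : ℂ) • 1 := by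
    rw [star_sub, a.2.star_eq, star_smul, star_one]
    simp only [Complex.star_def, Complex.conj_ofReal, sub_mul, mul_sub, smul_mul_assoc, one_mul,
      mul_smul_comm, mul_one]
    module
  rw [h2] at h1
  simp only [map_add, map_sub, map_smul, hr, h.map_one, smul_eq_mul] at h1
  have h3 := (Complex.le_def.1 h1).1
  simp at h3
  rw [hcov]
  constructor <;> nlinarith [mul_self_nonneg t]

lemma orbitMetric_self_nonneg {ρ : StrongDual ℂ A} (h : IsState ρ) (V : orbitTangent ρ) :
    0 ≤ orbitMetric ρ V V :=
  (h.jordanCov_nonneg_and_le (sld ρ V)).1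

lemma orbitMetric_symm (ρ : StrongDual ℂ A) (V W : orbitTangent ρ) :
    orbitMetric ρ V W = orbitMetric ρ W V :=
  jordanCov_symm ρ _ _

/-- The Cauchy–Schwarz inequality between a tangent vector of the orbit and an observable. -/
lemma sq_re_apply_le_orbitMetric_mul {ρ : StrongDual ℂ A} (h : IsState ρ) (V : orbitTangent ρ)
    (b : selfAdjoint A) :
    ((V : StrongDual ℂ A) (b : A)).re ^ 2 ≤ orbitMetric ρ V V * jordanCov ρ b b := by
  have hV : ((V : StrongDual ℂ A) (b : A)).re = jordanCov ρ (sld ρ V) b := by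
    rw [← gradient_sld ρ V]
    rfl
  rw [hV]
  -- `jordanCov` is only semidefinite: it vanishes on multiples of the identity, and `ρ` need not be
  -- faithful.
  exact LinearMap.BilinForm.apply_sq_le_of_symm _ (fun x => (h.jordanCov_nonneg_and_le x).1)
    ⟨fun x y => jordanCov_symm ρ x y⟩ _ _

/-- A tangent vector of the orbit takes, at its symmetric logarithmic derivative, its own squared
norm as value. -/
lemma re_apply_sld (ρ : StrongDual ℂ A) (V : orbitTangent ρ) :
    ((V : StrongDual ℂ A) (sld ρ V : A)).re = orbitMetric ρ V V := by
  conv_lhs => rw [← gradient_sld ρ V]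
  rfl

/-! ### Kadison–Schwarz for a commutative domain. -/

section Kadison

variable {X : Type*} [Fintype X] [DecidableEq X]

/-- An indicator is a projection, hence of the form `star f * f`. This presents `μ` as a positive
operator-valued measure with effects `star a * a`. -/
lemma IsMeasurement.exists_single {μ : (X → ℂ) →L[ℂ] A} (hμ : IsMeasurement μ) (x : X) :
    ∃ a : A, μ (Pi.single x 1) = star a * a := by
  obtain ⟨a, ha⟩ := hμ.pos (Pi.single x 1)
  refine ⟨a, ?_⟩
  rw [← ha]
  congr 1
  ext y
  by_cases h : y = x
  · subst h; simp
  · simp [h]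

lemma map_eq_sum_smul_single {F : Type*} [AddCommMonoid F] [TopologicalSpace F] [Module ℂ F]
    (μ : (X → ℂ) →L[ℂ] F) (f : X → ℂ) : μ f = ∑ x, f x • μ (Pi.single x 1) := by
  conv_lhs => rw [show f = ∑ x, f x • (Pi.single x 1 : X → ℂ) from pi_eq_sum_univ' f]
  simp only [map_sum, map_smul]

lemma IsMeasurement.map_isSelfAdjoint {μ : (X → ℂ) →L[ℂ] A} (hμ : IsMeasurement μ) {f : X → ℂ}
    (hf : IsSelfAdjoint f) : IsSelfAdjoint (μ f) := by
  rw [map_eq_sum_smul_single μ f, isSelfAdjoint_iff, star_sum]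
  refine Finset.sum_congr rfl fun x _ => ?_
  obtain ⟨a, ha⟩ := hμ.exists_single x
  have hfx : star (f x) = f x := congrFun hf.star_eq x
  rw [star_smul, ha, hfx, star_mul, star_star]

/-- The Kadison–Schwarz inequality for measurement procedures. -/
lemma IsMeasurement.re_map_mul_map_le {μ : (X → ℂ) →L[ℂ] A} (hμ : IsMeasurement μ)
    {ρ : StrongDual ℂ A} (h : IsState ρ) {f : X → ℂ} (hf : IsSelfAdjoint f) :
    (ρ (μ f * μ f)).re ≤ (ρ (μ (f * f))).re := by
  choose e he using hμ.exists_single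
  have hT := hμ.map_isSelfAdjoint hf
  set T := μ f with hTdef
  have h1 : ∑ x, star (e x) * e x = 1 := by
    rw [← hμ.map_one, map_eq_sum_smul_single μ 1]
    simp [he]
  have hsum : T = ∑ x, f x • (star (e x) * e x) := by
    rw [hTdef, map_eq_sum_smul_single μ f]
    simp [he]
  have hsq : μ (f * f) = ∑ x, (f x * f x) • (star (e x) * e x) := by
    rw [map_eq_sum_smul_single μ (f * f)]
    simp [he]
  -- The mean square deviation of `f` from the operator `T`, weighted by the effects. Since the
  -- effects sum to `1` and `∑ f x • effect x = T`, each cross term contributes `-T * T` and the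
  -- last term `T * T`.
  have key : μ (f * f) - T * T =
      ∑ x, star (e x * (f x • 1 - T)) * (e x * (f x • 1 - T)) := by
    have hx : ∀ x, star (e x * (f x • 1 - T)) * (e x * (f x • 1 - T)) =
        (f x * f x) • (star (e x) * e x) - (f x • (star (e x) * e x)) * T -
          T * (f x • (star (e x) * e x)) + T * (star (e x) * e x) * T := by
      intro x
      have hfx : star (f x) = f x := congrFun hf.star_eq x
      rw [star_mul, star_sub, star_smul, star_one, hT.star_eq, hfx]
      simp only [sub_mul, mul_sub, smul_mul_assoc, mul_smul_comm, one_mul, mul_one, mul_assoc,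
        smul_sub, smul_smul]
      abel
    simp only [hx, Finset.sum_add_distrib, Finset.sum_sub_distrib, ← Finset.sum_mul,
      ← Finset.mul_sum, h1, ← hsum, ← hsq]
    noncomm_ring
  have h2 : 0 ≤ ρ (μ (f * f) - T * T) := by
    rw [key, map_sum]
    exact Finset.sum_nonneg fun x _ => h.nonneg _
  have h3 := (Complex.le_def.1 h2).1
  simp only [map_sub, Complex.sub_re, Complex.zero_re] at h3
  linarith

end Kadison

end Inequalities

/-! ### Inverse forms on covectors. -/

section InverseForms

variable {V : Type*} [AddCommGroup V] [Module ℝ V]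

lemma apply_sharp (B : LinearMap.BilinForm ℝ V) (hB : IsInvertible B) (ξ : Module.Dual ℝ V) :
    B (sharp B hB ξ) = ξ :=
  (LinearEquiv.ofBijective B hB).apply_symm_apply ξ

lemma inverseForm_self (B : LinearMap.BilinForm ℝ V) (hB : IsInvertible B)
    (ξ : Module.Dual ℝ V) : inverseForm B hB ξ ξ = ξ (sharp B hB ξ) :=
  LinearMap.congr_fun (apply_sharp B hB ξ) _

/-- Every Cauchy–Schwarz argument below ends with the same factor on both sides. It may be zero, in
which case the bound comes from `0 ≤ y` and not from cancellation. -/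
lemma le_of_sq_le_mul {x y : ℝ} (hx : 0 ≤ x) (hy : 0 ≤ y) (h : x ^ 2 ≤ x * y) : x ≤ y := by
  rcases hx.eq_or_lt with rfl | hx
  · exact hy
  · rw [sq] at h
    exact le_of_mul_le_mul_left h hx

/-- Inversion reverses the order of positive symmetric bilinear forms. -/
lemma inverseForm_antitone {B B' : LinearMap.BilinForm ℝ V} (hB : IsInvertible B)
    (hB' : IsInvertible B') (hs : ∀ v w, B v w = B w v) (h0 : ∀ v, 0 ≤ B v v)
    (hle : ∀ v, B v v ≤ B' v v) (ξ : Module.Dual ℝ V) :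
    inverseForm B' hB' ξ ξ ≤ inverseForm B hB ξ ξ := by
  set v := sharp B hB ξ
  set w := sharp B' hB' ξ
  have e1 : inverseForm B' hB' ξ ξ = B' w w := rfl
  have e2 : inverseForm B hB ξ ξ = B v v := rfl
  -- `B v` and `B' w` are the same covector `ξ`, here evaluated at `w`.
  have e3 : B v w = B' w w := by
    rw [← e1, inverseForm_self, apply_sharp]
  rw [e1, e2]
  refine le_of_sq_le_mul ((h0 w).trans (hle w)) (h0 v) ?_
  calc B' w w ^ 2 = B v w ^ 2 := by rw [e3]
    _ ≤ B v v * B w w := LinearMap.BilinForm.apply_sq_le_of_symm _ h0 ⟨hs⟩ _ _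
    _ ≤ B v v * B' w w := mul_le_mul_of_nonneg_left (hle w) (h0 v)
    _ = B' w w * B v v := mul_comm _ _

end InverseForms

/-! ### Monotonicity of the metric under measurement. -/

section MetricComparison

variable {A E M X : Type*} [CStarAlgebra A] [FiniteDimensional ℂ A]
  [NormedAddCommGroup E] [NormedSpace ℝ E] [TopologicalSpace M] [ChartedSpace E M]
  [Fintype X] [DecidableEq X] [Nonempty X]

lemma ParametricModel.metric_self_nonneg (P : ParametricModel E M A) (m : M)
    (v : TangentSpace 𝓘(ℝ, E) m) : 0 ≤ P.metric m v v :=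
  orbitMetric_self_nonneg (P.isState m) _

lemma ParametricModel.metric_symm (P : ParametricModel E M A) (m : M)
    (v w : TangentSpace 𝓘(ℝ, E) m) : P.metric m v w = P.metric m w v :=
  orbitMetric_symm _ _ _

-- Chain rule: `ρ ↦ ρ ∘L μ` is linear, so it is its own derivative.
omit [DecidableEq X] in
lemma ParametricModel.tangentMap_statisticalModel (P : ParametricModel E M A)
    (μ : (X → ℂ) →L[ℂ] A) (hreg : P.IsRegular μ) (m : M) (v : TangentSpace 𝓘(ℝ, E) m) :
    ((P.statisticalModel μ hreg).tangentMap m v : StrongDual ℂ (X → ℂ)) =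
      (P.tangentMap m v : StrongDual ℂ A) ∘L μ := by
  let L : StrongDual ℂ A →L[ℝ] StrongDual ℂ (X → ℂ) :=
    ((ContinuousLinearMap.compL ℂ (X → ℂ) A ℂ).flip μ).restrictScalars ℝ
  have h : mfderiv 𝓘(ℝ, E) 𝓘(ℝ, StrongDual ℂ (X → ℂ)) (L ∘ P.toFun) m =
      (mfderiv 𝓘(ℝ, StrongDual ℂ A) 𝓘(ℝ, StrongDual ℂ (X → ℂ)) L (P.toFun m)).comp
        (mfderiv 𝓘(ℝ, E) 𝓘(ℝ, StrongDual ℂ A) P.toFun m) :=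
    mfderiv_comp m L.differentiableAt.mdifferentiableAt
      ((P.smooth m).mdifferentiableAt (by simp))
  rw [mfderiv_eq_fderiv, L.fderiv] at h
  exact congrArg (fun T : E →L[ℝ] StrongDual ℂ (X → ℂ) => T v) h

/-- Monotonicity of the metric under measurement procedures. -/
lemma ParametricModel.metric_statisticalModel_le (P : ParametricModel E M A)
    {μ : (X → ℂ) →L[ℂ] A} (hμ : IsMeasurement μ) (hreg : P.IsRegular μ) (m : M)
    (v : TangentSpace 𝓘(ℝ, E) m) :
    (P.statisticalModel μ hreg).metric m v v ≤ P.metric m v v := by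
  set Q := P.statisticalModel μ hreg with hQ
  let W := Q.tangentMap m v
  let V := P.tangentMap m v
  -- The classical observable at which Cauchy–Schwarz is an equality; its image `b` under `μ` is the
  -- test observable on the noncommutative side.
  let f := sld (Q.toFun m) W
  let b : selfAdjoint A := ⟨μ f, hμ.map_isSelfAdjoint f.2⟩
  have e0 : Q.metric m v v = jordanCov (Q.toFun m) f f := rfl
  have e1 : Q.metric m v v = ((V : StrongDual ℂ A) (b : A)).re := by
    have h1 : Q.metric m v v = ((W : StrongDual ℂ (X → ℂ)) (f : X → ℂ)).re :=
      (re_apply_sld (Q.toFun m) W).symm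
    rw [h1, show (W : StrongDual ℂ (X → ℂ)) = (V : StrongDual ℂ A) ∘L μ from
      P.tangentMap_statisticalModel μ hreg m v]
    rfl
  -- The means of `b` and `f` agree by definition of the statistical model, so only the second
  -- moments are compared.
  have hb : jordanCov (P.toFun m) b b ≤ jordanCov (Q.toFun m) f f := by
    have e2 : (1 / 2 : ℂ) • ((b : A) * b + (b : A) * b) = (b : A) * b := by module
    have e3 : (1 / 2 : ℂ) • ((f : X → ℂ) * f + (f : X → ℂ) * f) = (f : X → ℂ) * f := by module
    rw [jordanCov_apply, jordanCov_apply, e2, e3, Complex.sub_re, Complex.sub_re]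
    exact sub_le_sub_right (hμ.re_map_mul_map_le (P.isState m) f.2) _
  refine le_of_sq_le_mul (Q.metric_self_nonneg m v) (P.metric_self_nonneg m v) ?_
  rw [mul_comm]
  calc Q.metric m v v ^ 2 = ((V : StrongDual ℂ A) (b : A)).re ^ 2 := by rw [e1]
    _ ≤ P.metric m v v * jordanCov (P.toFun m) b b :=
      sq_re_apply_le_orbitMetric_mul (P.isState m) V b
    _ ≤ P.metric m v v * Q.metric m v v :=
      mul_le_mul_of_nonneg_left hb (P.metric_self_nonneg m v)

end MetricComparison

/-! ### Differentiating the stationarity condition, and the Cramér–Rao bound. -/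

section Stationarity

variable {E M X : Type*} [NormedAddCommGroup E] [NormedSpace ℝ E]
  [TopologicalSpace M] [ChartedSpace E M]

/-- The differential of a map to a normed space, read in the preferred chart. -/
lemma hasFDerivAt_comp_extChartAt_symm {F : Type*} [NormedAddCommGroup F] [NormedSpace ℝ F]
    {f : M → F} {m : M} (hf : MDifferentiableAt 𝓘(ℝ, E) 𝓘(ℝ, F) f m) :
    HasFDerivAt (fun y : E => f ((extChartAt 𝓘(ℝ, E) m).symm y))
      (mfderiv 𝓘(ℝ, E) 𝓘(ℝ, F) f m : E →L[ℝ] F) (extChartAt 𝓘(ℝ, E) m m) := by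
  have h := hf.hasMFDerivAt.2
  simp only [writtenInExtChartAt, extChartAt_model_space_eq_id, modelWithCornersSelf_coe,
    Set.range_id] at h
  exact hasFDerivWithinAt_univ.1 h

lemma contDiffOn_comp_extChartAt_symm [IsManifold 𝓘(ℝ, E) ∞ M] {F : Type*}
    [NormedAddCommGroup F] [NormedSpace ℝ F] {f : M → F}
    (hf : ContMDiff 𝓘(ℝ, E) 𝓘(ℝ, F) ∞ f) (m : M) :
    ContDiffOn ℝ ∞ (fun y : E => f ((extChartAt 𝓘(ℝ, E) m).symm y))
      (extChartAt 𝓘(ℝ, E) m).target :=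
  (hf.comp_contMDiffOn (contMDiffOn_extChartAt_symm (I := 𝓘(ℝ, E)) (n := ∞) m)).contDiffOn

/-- Stationarity at a nearby point concerns the differential at that point. Differentiating the
condition along `M` requires it in one fixed chart, that of `m`, and the chain rule carries it
there. -/
lemma fderiv_comp_extChartAt_symm_eq_zero [IsManifold 𝓘(ℝ, E) ∞ M] {f : M → ℝ}
    (hf : ContMDiff 𝓘(ℝ, E) 𝓘(ℝ, ℝ) ∞ f) (m : M) {y : E}
    (hy : y ∈ (extChartAt 𝓘(ℝ, E) m).target)
    (h0 : differential (E := E) f ((extChartAt 𝓘(ℝ, E) m).symm y) = 0) :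
    fderiv ℝ (fun y : E => f ((extChartAt 𝓘(ℝ, E) m).symm y)) y = 0 := by
  have h1 : MDifferentiableAt 𝓘(ℝ, E) 𝓘(ℝ, E) (extChartAt 𝓘(ℝ, E) m).symm y :=
    ((contMDiffOn_extChartAt_symm (I := 𝓘(ℝ, E)) (n := ∞) m).contMDiffAt
      ((isOpen_extChartAt_target m).mem_nhds hy)).mdifferentiableAt (by simp)
  have h2 := mfderiv_comp y ((hf _).mdifferentiableAt (by simp)) h1
  rw [mfderiv_eq_fderiv] at h2
  refine ContinuousLinearMap.ext fun v => ?_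
  have h3 := congrArg (fun T : E →L[ℝ] ℝ => T v) h2
  exact h3.trans (LinearMap.congr_fun h0 _)

lemma IsCostFunction.contMDiff_left {C : M → M → ℝ} (hC : IsCostFunction E C) (p : M) :
    ContMDiff 𝓘(ℝ, E) 𝓘(ℝ, ℝ) ∞ fun m => C m p :=
  hC.smooth.comp (contMDiff_id.prodMk contMDiff_const)

variable [Fintype X] [DecidableEq X]

lemma contMDiff_loss (Q : ParametricModel E M (X → ℂ)) {C : M → M → ℝ}
    (hC : IsCostFunction E C) (est : X → M) (m₂ : M) :
    ContMDiff 𝓘(ℝ, E) 𝓘(ℝ, ℝ) ∞ fun m₁ => loss Q C est m₁ m₂ := by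
  unfold loss
  exact contMDiff_finsetSum fun x _ => (hC.contMDiff_left (est x)).mul contMDiff_const

/-- The evaluation at the indicator of an outcome, real part. -/
def outcomeCLM (x : X) : StrongDual ℂ (X → ℂ) →L[ℝ] ℝ :=
  Complex.reCLM ∘L (ContinuousLinearMap.apply ℂ ℂ (Pi.single x 1 : X → ℂ)).restrictScalars ℝ

/-- The second variation of the expected cost of an estimator which is stationary near `m`
equals minus the mixed variation of the costs and the probabilities. -/
lemma hessian_loss_apply [IsManifold 𝓘(ℝ, E) ∞ M] (Q : ParametricModel E M (X → ℂ))
    {C : M → M → ℝ} (hC : IsCostFunction E C) {est : X → M} {m : M}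
    (hst : ∀ᶠ m' in 𝓝 m, IsStationary Q C est m') (v w : TangentSpace 𝓘(ℝ, E) m) :
    hessian (E := E) (fun m₁ => loss Q C est m₁ m) m v w =
      -∑ x, ((Q.tangentMap m v : StrongDual ℂ (X → ℂ)) (Pi.single x 1)).re *
        differential (fun m₁ => C m₁ (est x)) m w := by
  set φ := extChartAt 𝓘(ℝ, E) m with hφ
  let F : X → E → ℝ := fun x y => C (φ.symm y) (est x)
  let q : X → E → ℝ := fun x y => outcomeCLM x (Q.toFun (φ.symm y))
  have hloss : ∀ m₂ y, loss Q C est (φ.symm y) m₂ = ∑ x, F x y * Q.prob m₂ x :=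
    fun m₂ y => rfl
  have hy₀ : φ m ∈ φ.target := mem_extChartAt_target m
  have htn : φ.target ∈ 𝓝 (φ m) := extChartAt_target_mem_nhds m
  have hFs : ∀ x, ContDiffOn ℝ ∞ (F x) φ.target := fun x =>
    contDiffOn_comp_extChartAt_symm (hC.contMDiff_left (est x)) m
  have hFd : ∀ x, ∀ y ∈ φ.target, DifferentiableAt ℝ (F x) y := fun x y hy =>
    ((hFs x).contDiffAt ((isOpen_extChartAt_target m).mem_nhds hy)).differentiableAt (by simp)
  have hF2 : ∀ x, HasFDerivAt (fderiv ℝ (F x)) (fderiv ℝ (fderiv ℝ (F x)) (φ m)) (φ m) :=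
    fun x => ((((hFs x).contDiffAt htn).fderiv_right (m := 1)
      (by norm_cast)).differentiableAt (by simp)).hasFDerivAt
  have hFm : ∀ x (u : E), fderiv ℝ (F x) (φ m) u =
      differential (E := E) (fun m₁ => C m₁ (est x)) m u := by
    intro x u
    let D' : E →L[ℝ] ℝ := mfderiv 𝓘(ℝ, E) 𝓘(ℝ, ℝ) (fun m₁ => C m₁ (est x)) m
    have h : HasFDerivAt (F x) D' (φ m) := hasFDerivAt_comp_extChartAt_symm
      ((hC.contMDiff_left (est x) m).mdifferentiableAt (by simp))
    exact congrArg (fun T : E →L[ℝ] ℝ => T u) h.fderiv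
  let D : E →L[ℝ] StrongDual ℂ (X → ℂ) :=
    mfderiv 𝓘(ℝ, E) 𝓘(ℝ, StrongDual ℂ (X → ℂ)) Q.toFun m
  have hq : ∀ x, HasFDerivAt (q x) (outcomeCLM x ∘L D) (φ m) := fun x =>
    (outcomeCLM x).hasFDerivAt.comp (φ m)
      (hasFDerivAt_comp_extChartAt_symm ((Q.smooth m).mdifferentiableAt (by simp)))
  have hderiv : ∀ m₂, ∀ y ∈ φ.target,
      HasFDerivAt (fun y => loss Q C est (φ.symm y) m₂)
        (∑ x, Q.prob m₂ x • fderiv ℝ (F x) y) y := by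
    intro m₂ y hy
    simp only [hloss]
    exact HasFDerivAt.fun_sum fun x _ => (hFd x y hy).hasFDerivAt.mul_const (Q.prob m₂ x)
  have hsum2 : ∀ (T : X → E →L[ℝ] E →L[ℝ] ℝ) (a b : E), (∑ x, T x) a b = ∑ x, T x a b := by
    intro T a b
    simp
  -- The probabilities are frozen at `m`, so only the costs are differentiated twice.
  have hH : hessian (E := E) (fun m₁ => loss Q C est m₁ m) m v w =
      ∑ x, Q.prob m x * fderiv ℝ (fderiv ℝ (F x)) (φ m) v w := by
    have heq : fderiv ℝ (fun y => loss Q C est (φ.symm y) m) =ᶠ[𝓝 (φ m)]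
        fun y => ∑ x, Q.prob m x • fderiv ℝ (F x) y := by
      filter_upwards [htn] with y hy using (hderiv m y hy).fderiv
    have h1 : HasFDerivAt (fun y => ∑ x, Q.prob m x • fderiv ℝ (F x) y)
        (∑ x, Q.prob m x • fderiv ℝ (fderiv ℝ (F x)) (φ m)) (φ m) :=
      HasFDerivAt.fun_sum fun x _ => (hF2 x).const_smul (Q.prob m x)
    have h2 := heq.fderiv_eq.trans h1.fderiv
    have h3 := congrArg (fun T : E →L[ℝ] E →L[ℝ] ℝ => T v w) h2
    refine Eq.trans (b := (∑ x, Q.prob m x • fderiv ℝ (fderiv ℝ (F x)) (φ m)) v w) h3 ?_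
    exact hsum2 _ v w
  -- Stationarity at the point with coordinate `y`: the loss is differentiated with its second
  -- argument frozen, and that argument is then set to the same point. The probabilities `q x y`
  -- therefore vary with `y` in an identity valid on a whole neighbourhood.
  have hzero : (fun y => ∑ x, q x y • fderiv ℝ (F x) y) =ᶠ[𝓝 (φ m)] fun _ => 0 := by
    have hcont : Filter.Tendsto φ.symm (𝓝 (φ m)) (𝓝 m) := by
      have h := (continuousAt_extChartAt_symm (I := 𝓘(ℝ, E)) m).tendsto
      rwa [extChartAt_to_inv] at h
    filter_upwards [htn, hcont.eventually hst] with y hy hs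
    have h1 := fderiv_comp_extChartAt_symm_eq_zero
      (contMDiff_loss Q hC est (φ.symm y)) m hy hs
    rw [← h1]
    exact (hderiv (φ.symm y) y hy).fderiv.symm
  -- The product rule splits the derivative of the zero function into the Hessian term and the mixed
  -- term.
  have h1 : HasFDerivAt (fun y => ∑ x, q x y • fderiv ℝ (F x) y)
      (∑ x, (q x (φ m) • fderiv ℝ (fderiv ℝ (F x)) (φ m) +
        (outcomeCLM x ∘L D).smulRight (fderiv ℝ (F x) (φ m)))) (φ m) :=
    HasFDerivAt.fun_sum fun x _ => (hq x).smul (hF2 x)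
  have h2 := (h1.congr_of_eventuallyEq hzero.symm).unique (hasFDerivAt_const _ _)
  have h3 : (∑ x, (q x (φ m) • fderiv ℝ (fderiv ℝ (F x)) (φ m) +
      (outcomeCLM x ∘L D).smulRight (fderiv ℝ (F x) (φ m)))) v w = 0 := by
    rw [h2]; rfl
  have hqm : ∀ x, q x (φ m) = Q.prob m x := by
    intro x
    simp only [q, hφ, extChartAt_to_inv]
    rfl
  rw [hH, eq_neg_iff_add_eq_zero, ← Finset.sum_add_distrib, ← h3]
  refine Eq.trans ?_ (hsum2 _ v w).symm
  refine Finset.sum_congr rfl fun x _ => ?_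
  exact congrArg₂ (fun a b : ℝ => a * fderiv ℝ (fderiv ℝ (F x)) (φ m) v w +
    outcomeCLM x (D v) * b) (hqm x).symm (hFm x w).symm

/-- Symmetry of second derivatives in the chart. It is needed because `sharp` puts `H⁻¹ξ` in the
first slot, whereas `hessian_loss_apply` differentiates the probabilities along the first slot and
the costs along the second. -/
lemma hessian_symm [IsManifold 𝓘(ℝ, E) ∞ M] {f : M → ℝ}
    (hf : ContMDiff 𝓘(ℝ, E) 𝓘(ℝ, ℝ) ∞ f) {m : M} (v w : TangentSpace 𝓘(ℝ, E) m) :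
    hessian f m v w = hessian f m w v := by
  have h := ((contDiffOn_comp_extChartAt_symm hf m).contDiffAt
    (extChartAt_target_mem_nhds m)).isSymmSndFDerivAt (by simp; norm_cast)
  exact h v w

lemma ParametricModel.re_apply_eq_sum_prob (Q : ParametricModel E M (X → ℂ)) (m : M)
    (f : X → ℝ) : (Q.toFun m fun x => (f x : ℂ)).re = ∑ x, f x * Q.prob m x := by
  rw [map_eq_sum_smul_single (Q.toFun m)]
  simp [ParametricModel.prob]

/-- The generalized Cramér–Rao bound. -/
lemma inverseForm_metric_le_covariance [IsManifold 𝓘(ℝ, E) ∞ M]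
    (Q : ParametricModel E M (X → ℂ)) {C : M → M → ℝ} (hC : IsCostFunction E C) {est : X → M}
    {m : M} (hst : ∀ᶠ m' in 𝓝 m, IsStationary Q C est m') (hG : IsInvertible (Q.metric m))
    (hH : IsInvertible (hessian (E := E) (fun m₁ => loss Q C est m₁ m) m))
    (ξ : Module.Dual ℝ (TangentSpace 𝓘(ℝ, E) m)) :
    inverseForm (Q.metric m) hG ξ ξ ≤ covariance Q C est m hH ξ ξ := by
  set v := sharp _ hH ξ with hv
  set u := sharp (Q.metric m) hG ξ with hu
  -- The random variable to which Cauchy–Schwarz is applied: the derivative of each cost along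
  -- `H⁻¹ξ`. Its second moment is the covariance.
  let c : X → ℝ := fun x => differential (fun m₁ => C m₁ (est x)) m v
  let h : selfAdjoint (X → ℂ) := ⟨fun x => (c x : ℂ), by
    ext x
    exact Complex.conj_ofReal _⟩
  let W := Q.tangentMap m u
  have hcov : covariance Q C est m hH ξ ξ = (Q.toFun m ((h : X → ℂ) * h)).re := by
    have h1 : ((h : X → ℂ) * h) = fun x => ((c x * c x : ℝ) : ℂ) := by
      ext x
      exact (Complex.ofReal_mul _ _).symm
    rw [h1, Q.re_apply_eq_sum_prob]
    change costForm Q C est m v v = _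
    simp only [costForm, LinearMap.sum_apply, LinearMap.smul_apply,
      LinearMap.BilinForm.linMulLin_apply, smul_eq_mul]
    exact Finset.sum_congr rfl fun x _ => mul_comm _ _
  have hcov0 : 0 ≤ covariance Q C est m hH ξ ξ := by
    have h1 := (Complex.le_def.1 ((Q.isState m).nonneg (h : X → ℂ))).1
    rw [h.2.star_eq] at h1
    rw [hcov]
    exact h1
  have hinv : inverseForm (Q.metric m) hG ξ ξ = -((W : StrongDual ℂ (X → ℂ)) (h : X → ℂ)).re := by
    rw [inverseForm_self, ← hu]
    have h1 : ξ u = hessian (E := E) (fun m₁ => loss Q C est m₁ m) m u v := by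
      rw [hessian_symm (contMDiff_loss Q hC est m), hv, apply_sharp]
    rw [h1, hessian_loss_apply Q hC hst, map_eq_sum_smul_single (W : StrongDual ℂ (X → ℂ))]
    congr 1
    simp only [Complex.re_sum]
    refine Finset.sum_congr rfl fun x _ => ?_
    rw [mul_comm]
    exact (Complex.re_ofReal_mul _ _).symm
  -- `G⁻¹(ξ,ξ)` is the squared length of `u = G⁻¹ξ`, so the same number occurs on both sides of the
  -- estimate.
  have hnn : inverseForm (Q.metric m) hG ξ ξ = orbitMetric (Q.toFun m) W W := rfl
  refine le_of_sq_le_mul (Q.metric_self_nonneg m u) hcov0 ?_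
  calc inverseForm (Q.metric m) hG ξ ξ ^ 2
      = ((W : StrongDual ℂ (X → ℂ)) (h : X → ℂ)).re ^ 2 := by rw [hinv, neg_sq]
    _ ≤ orbitMetric (Q.toFun m) W W * jordanCov (Q.toFun m) h h :=
      sq_re_apply_le_orbitMetric_mul (Q.isState m) W h
    -- The variance is replaced by the second moment. Nothing is lost, since stationarity at `m`
    -- makes the mean of `h` zero, but only the inequality is used.
    _ ≤ inverseForm (Q.metric m) hG ξ ξ * covariance Q C est m hH ξ ξ := by
      rw [hcov, hnn]
      exact mul_le_mul_of_nonneg_left ((Q.isState m).jordanCov_nonneg_and_le h).2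
        (Q.metric_self_nonneg m u)

end Stationarity

end CStarEstimation

end

theorem mainTheorem1 {A E M X : Type*} [CStarAlgebra A] [FiniteDimensional ℂ A]
    [NormedAddCommGroup E] [NormedSpace ℝ E] [FiniteDimensional ℝ E]
    [TopologicalSpace M] [ChartedSpace E M] [IsManifold 𝓘(ℝ, E) ∞ M]
    [Fintype X] [DecidableEq X] [Nonempty X]
    (P : ParametricModel E M A) (μ : (X → ℂ) →L[ℂ] A) (hμ : IsMeasurement μ)
    (hreg : P.IsRegular μ)
    (hG : ∀ m, IsInvertible (P.metric m))
    (hGc : ∀ m, IsInvertible ((P.statisticalModel μ hreg).metric m)) :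
    (∀ (C : M → M → ℝ) (_ : IsCostFunction E C) (est : X → M) (m : M)
      (_ : ∀ᶠ m' in 𝓝 m, IsStationary (P.statisticalModel μ hreg) C est m')
      (hH : IsInvertible
        (hessian (E := E) (fun m₁ => loss (P.statisticalModel μ hreg) C est m₁ m) m))
      (ξ : Module.Dual ℝ (TangentSpace 𝓘(ℝ, E) m)),
      inverseForm ((P.statisticalModel μ hreg).metric m) (hGc m) ξ ξ ≤
          covariance (P.statisticalModel μ hreg) C est m hH ξ ξ ∧
        inverseForm (P.metric m) (hG m) ξ ξ ≤
          inverseForm ((P.statisticalModel μ hreg).metric m) (hGc m) ξ ξ) ∧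
    ∀ (m : M) (ξ : Module.Dual ℝ (TangentSpace 𝓘(ℝ, E) m)),
      inverseForm (P.metric m) (hG m) ξ ξ ≤
        inverseForm ((P.statisticalModel μ hreg).metric m) (hGc m) ξ ξ := by
  have h2 : ∀ (m : M) (ξ : Module.Dual ℝ (TangentSpace 𝓘(ℝ, E) m)),
      inverseForm (P.metric m) (hG m) ξ ξ ≤
        inverseForm ((P.statisticalModel μ hreg).metric m) (hGc m) ξ ξ := fun m ξ =>
    -- The classical metric is the smaller form, hence the one whose symmetry and positivity are
    -- supplied.
    inverseForm_antitone (hGc m) (hG m) ((P.statisticalModel μ hreg).metric_symm m)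
      ((P.statisticalModel μ hreg).metric_self_nonneg m)
      (P.metric_statisticalModel_le hμ hreg m) ξ
  exact ⟨fun C hC est m hst hH ξ =>
    ⟨inverseForm_metric_le_covariance _ hC hst (hGc m) hH ξ, h2 m ξ⟩, h2⟩
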